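/- For $n\ge 1$ let $B_n\subseteq\mathbb R^{n\times n}$ be the Birkhoff polytope, the convex hull of all $n\times n$ permutation matrices. The combinatorial type of a polytope $P$ is the isomorphism class of its face lattice, i.e. the set of all faces of $P$ (including $\varnothing$ and $P$) ordered by inclusion. If $\mathcal L$ is the combinatorial type of a face of some Birkhoff polytope, its Birkhoff dimension $\mathrm{bdim}(\mathcal L)$ is the smallest $n\ge 1$ such that $B_n$ has a face of combinatorial type $\mathcal L$. If $Q$ is a polytope and $R=\{x\in Q:\langle c,x\rangle=b\}$ is the (possibly empty) face of $Q$ defined by a valid inequality $\langle c,x\rangle\le b$, the wedge of $Q$ over $R$ is the polytope $\{(x,x_0): x\in Q,\ 0\le x_0\le b-\langle c,x\rangle\}$; its combinatorial type depends only on $Q$ and $R$. Let $d\ge 1$ and let $\mathcal L$ be the combinatorial type of a $d$-dimensional face of some Birkhoff polytope. If $\mathrm{bdim}(\mathcal L)\ge d$, then at least one of the following holds: 1. $\mathcal L$ is the combinatorial type of the wedge of $Q$ over $R$, where $Q$ is a face of some Birkhoff polytope with $\dim Q<d$ and $R$ is a face of $Q$; 2. $\mathcal L$ is the combinatorial type of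 a product $Q_1\times Q_2$, where $Q_1,Q_2$ are nonempty faces of Birkhoff polytopes with $\dim Q_1<d$ and $\dim Q_2<d$. -/

import Mathlib

namespace BirkhoffFaces

section Polytopes

variable {E : Type*} [AddCommGroup E] [Module ℝ E] [TopologicalSpace E]

/-- The poset, ordered by inclusion, of all faces of a polytope `P`: the sets
`P ∩ H` for a supporting hyperplane `H`, the empty set, and `P` itself.
(`IsExposed ℝ P F` holds for `F = ∅`, and for `F = P` through the zero functional.) -/
abbrev FaceLattice (P : Set E) : Type _ := {F : Set E // IsExposed ℝ P F}

/-- The poset `L` is the combinatorial type of the polytope `P`. -/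
def IsTypeOf (L : Type*) [PartialOrder L] (P : Set E) : Prop :=
  Nonempty (L ≃o FaceLattice P)

/-- `P` is nonempty and its affine hull has dimension `d`. -/
def HasDim (P : Set E) (d : ℕ) : Prop :=
  P.Nonempty ∧ Module.finrank ℝ (vectorSpan ℝ P) = d

/-- The inequality `⟨c, x⟩ ≤ b` is valid on `Q` and defines the (possibly empty) face `R`. -/
def DefinesFace (c : E →L[ℝ] ℝ) (b : ℝ) (Q R : Set E) : Prop :=
  (∀ x ∈ Q, c x ≤ b) ∧ R = {x ∈ Q | c x = b}

/-- The wedge `{(x, x₀) | x ∈ Q, 0 ≤ x₀ ≤ b - ⟨c, x⟩}` built from the inequality `⟨c, x⟩ ≤ b`. -/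
def wedge (Q : Set E) (c : E →L[ℝ] ℝ) (b : ℝ) : Set (E × ℝ) :=
  {p | p.1 ∈ Q ∧ 0 ≤ p.2 ∧ p.2 ≤ b - c p.1}

/-- The combinatorial type `L` is a wedge of the polytope `Q` over its face `R`. -/
def IsWedgeOver (L : Type*) [PartialOrder L] (Q R : Set E) : Prop :=
  ∃ (c : E →L[ℝ] ℝ) (b : ℝ), DefinesFace c b Q R ∧ IsTypeOf L (wedge Q c b)

end Polytopes

/-- The `n`-th Birkhoff polytope, the convex hull of the `n × n` permutation matrices. -/
def birkhoff (n : ℕ) : Set (Matrix (Fin n) (Fin n) ℝ) :=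
  convexHull ℝ {M | ∃ σ : Equiv.Perm (Fin n), M = σ.permMatrix ℝ}

/-- `F` is a `d`-dimensional face of the `n`-th Birkhoff polytope. -/
def IsBirkhoffFace (n d : ℕ) (F : Set (Matrix (Fin n) (Fin n) ℝ)) : Prop :=
  0 < n ∧ IsExposed ℝ (birkhoff n) F ∧ HasDim F d

/-- The Birkhoff dimension of `L`: the least `n ≥ 1` such that the `n`-th Birkhoff polytope
has a face of combinatorial type `L`. -/
noncomputable def bdim (L : Type*) [PartialOrder L] : ℕ :=
  sInf {n : ℕ | 0 < n ∧ ∃ F : Set (Matrix (Fin n) (Fin n) ℝ),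
    IsExposed ℝ (birkhoff n) F ∧ IsTypeOf L F}

/-- `L` is a wedge of a face `Q` of some Birkhoff polytope, `dim Q < d`, over a face `R` of `Q`. -/
def IsWedgeOfLowerFace (L : Type*) [PartialOrder L] (d : ℕ) : Prop :=
  ∃ (k e : ℕ) (Q R : Set (Matrix (Fin k) (Fin k) ℝ)),
    e < d ∧ IsBirkhoffFace k e Q ∧ IsExposed ℝ Q R ∧ IsWedgeOver L Q R

/-- `L` is the product of two faces of Birkhoff polytopes, both of dimension `< d`. -/
def IsProductOfLowerFaces (L : Type*) [PartialOrder L] (d : ℕ) : Prop :=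
  ∃ (k₁ k₂ e₁ e₂ : ℕ) (Q₁ : Set (Matrix (Fin k₁) (Fin k₁) ℝ))
    (Q₂ : Set (Matrix (Fin k₂) (Fin k₂) ℝ)),
    e₁ < d ∧ e₂ < d ∧ IsBirkhoffFace k₁ e₁ Q₁ ∧ IsBirkhoffFace k₂ e₂ Q₂ ∧ IsTypeOf L (Q₁ ×ˢ Q₂)

end BirkhoffFaces

namespace BirkhoffFaces

open Finset

/-! The first alternative always holds, by descent on `n`. A nonempty face `F` of `B_n` is
determined by its support `S`, the set of positions where some point of `F` is nonzero
(`exists_support`). On `S` the row and column sums impose at most `2n - 1` independent conditions,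
so `|S| ≤ d + 2n - 1` (`card_support_le`). Every `n` for which the type occurs in `B_n` satisfies `n
≥ bdim ≥ d`, hence `|S| < 3n`, and some row `v` has at most two support positions.

If `v` has a single position, or its two columns `u`, `w` share no other row of `S`, then deleting
`v` and adding one column to another is a linear bijection from `F` onto a face of `B_{n-1}`
(`exists_smaller_face`), and the descent continues. Otherwise another row `v'` meets both columns.
Sliding along the 2 × 2 exchange on rows `v`, `v'` and columns `u`, `w` until the entry `(v', w)`
vanishes exhibits `F` as a wedge over the facet-like slice where that entry is zero
(`isWedgeOfLowerFace_of_common_row`). The descent must end in this case, since there is no face with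
`n = 0`. -/

theorem finrank_vectorSpan_image_le {E E' : Type*} [AddCommGroup E] [Module ℝ E]
    [AddCommGroup E'] [Module ℝ E'] [FiniteDimensional ℝ E] (f : E →ₗ[ℝ] E') (P : Set E) :
    Module.finrank ℝ (vectorSpan ℝ (f '' P)) ≤ Module.finrank ℝ (vectorSpan ℝ P) := by
  have h := (f.toAffineMap).map_vectorSpan (s := P)
  rw [LinearMap.coe_toAffineMap] at h
  rw [← h]
  exact Submodule.finrank_map_le _ _

/-- Linearly isomorphic sets have the same dimension. -/
theorem HasDim.of_linear {E E' : Type*} [AddCommGroup E] [Module ℝ E]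
    [AddCommGroup E'] [Module ℝ E'] [FiniteDimensional ℝ E] [FiniteDimensional ℝ E'] {P : Set E}
    {P' : Set E'} {d : ℕ} (f : E →ₗ[ℝ] E') (g : E' →ₗ[ℝ] E)
    (hf : ∀ x ∈ P, f x ∈ P') (hg : ∀ y ∈ P', g y ∈ P) (hgf : ∀ x ∈ P, g (f x) = x)
    (hfg : ∀ y ∈ P', f (g y) = y) (hP : HasDim P d) : HasDim P' d := by
  have h1 : f '' P = P' :=
    Set.Subset.antisymm (Set.image_subset_iff.2 hf) fun y hy => ⟨g y, hg y hy, hfg y hy⟩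
  have h2 : g '' P' = P :=
    Set.Subset.antisymm (Set.image_subset_iff.2 hg) fun x hx => ⟨f x, hf x hx, hgf x hx⟩
  refine ⟨h1 ▸ hP.1.image f, le_antisymm ?_ ?_⟩
  · rw [← hP.2, ← h1]
    exact finrank_vectorSpan_image_le f P
  · rw [← hP.2]
    conv_lhs => rw [← h2]
    exact finrank_vectorSpan_image_le g P'

/-! ### Exposed faces under linear maps. -/

section Polytopes

variable {E E' : Type*} [AddCommGroup E] [Module ℝ E] [TopologicalSpace E]
  [AddCommGroup E'] [Module ℝ E'] [TopologicalSpace E']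

/-- A linear bijection between two sets carries exposed faces to exposed faces. -/
theorem isExposed_image [IsTopologicalAddGroup E'] [ContinuousSMul ℝ E'] [T2Space E']
    [FiniteDimensional ℝ E'] {P A : Set E} {P' : Set E'} (f : E →ₗ[ℝ] E') (g : E' →ₗ[ℝ] E)
    (hf : ∀ x ∈ P, f x ∈ P') (hg : ∀ y ∈ P', g y ∈ P) (hgf : ∀ x ∈ P, g (f x) = x)
    (hfg : ∀ y ∈ P', f (g y) = y) (hA : IsExposed ℝ P A) : IsExposed ℝ P' (f '' A) := by
  intro hne
  obtain ⟨l, hl⟩ := hA (Set.image_nonempty.1 hne)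
  refine ⟨LinearMap.toContinuousLinearMap ((l : E →ₗ[ℝ] ℝ) ∘ₗ g), ?_⟩
  ext y
  simp only [LinearMap.coe_toContinuousLinearMap', LinearMap.comp_apply,
    ContinuousLinearMap.coe_coe, Set.mem_image, Set.mem_ofPred_eq]
  constructor
  · rintro ⟨x, hx, rfl⟩
    rw [hl] at hx
    refine ⟨hf x hx.1, fun y hy => ?_⟩
    rw [hgf x hx.1]
    exact hx.2 _ (hg y hy)
  · rintro ⟨hy, hmax⟩
    refine ⟨g y, ?_, hfg y hy⟩
    rw [hl]
    refine ⟨hg y hy, fun x hx => ?_⟩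
    have := hmax (f x) (hf x hx)
    rwa [hgf x hx] at this

/-- Linearly isomorphic sets have the same combinatorial type. -/
theorem IsTypeOf.of_linear [IsTopologicalAddGroup E] [ContinuousSMul ℝ E] [T2Space E]
    [FiniteDimensional ℝ E] [IsTopologicalAddGroup E'] [ContinuousSMul ℝ E'] [T2Space E']
    [FiniteDimensional ℝ E'] {L : Type*} [PartialOrder L] {P : Set E} {P' : Set E'}
    (f : E →ₗ[ℝ] E') (g : E' →ₗ[ℝ] E)
    (hf : ∀ x ∈ P, f x ∈ P') (hg : ∀ y ∈ P', g y ∈ P) (hgf : ∀ x ∈ P, g (f x) = x)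
    (hfg : ∀ y ∈ P', f (g y) = y) (hP : IsTypeOf L P) : IsTypeOf L P' := by
  obtain ⟨e⟩ := hP
  have left {A : Set E} (hA : A ⊆ P) : g '' (f '' A) = A := by
    rw [Set.image_image]
    exact (Set.image_congr fun x hx => hgf x (hA hx)).trans (Set.image_id' A)
  have right {A : Set E'} (hA : A ⊆ P') : f '' (g '' A) = A := by
    rw [Set.image_image]
    exact (Set.image_congr fun x hx => hfg x (hA hx)).trans (Set.image_id' A)
  refine ⟨e.trans
    { toFun := fun A => ⟨f '' A.1, isExposed_image f g hf hg hgf hfg A.2⟩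
      invFun := fun B => ⟨g '' B.1, isExposed_image g f hg hf hfg hgf B.2⟩
      left_inv := fun A => Subtype.ext (left A.2.subset)
      right_inv := fun B => Subtype.ext (right B.2.subset)
      map_rel_iff' := ?_ }⟩
  intro A B
  constructor
  · intro h
    have h' : f '' A.1 ⊆ f '' B.1 := h
    have := Set.image_mono (f := g) h'
    rwa [left A.2.subset, left B.2.subset] at this
  · intro h
    exact Set.image_mono (f := f) (show A.1 ⊆ B.1 from h)

/-- The preimage of an exposed face under a linear map is an exposed face. -/
theorem isExposed_preimage [IsTopologicalAddGroup E'] [ContinuousSMul ℝ E'] [T2Space E']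
    [FiniteDimensional ℝ E'] {P A : Set E} {P' : Set E'} (g : E' →ₗ[ℝ] E)
    (hg : ∀ y ∈ P', g y ∈ P) (hA : IsExposed ℝ P A) : IsExposed ℝ P' {y ∈ P' | g y ∈ A} := by
  rintro ⟨y₀, hy₀, hgy₀⟩
  obtain ⟨l, hl⟩ := hA ⟨_, hgy₀⟩
  refine ⟨LinearMap.toContinuousLinearMap ((l : E →ₗ[ℝ] ℝ) ∘ₗ g), ?_⟩
  rw [hl] at hgy₀ ⊢
  ext y
  simp only [LinearMap.coe_toContinuousLinearMap', LinearMap.comp_apply,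
    ContinuousLinearMap.coe_coe, Set.mem_ofPred_eq]
  -- Since `g y₀ ∈ A`, the maximum of `l` over `P` is already attained on `g '' P'`, so maximizing
  -- over `P'` is maximizing over `P`.
  exact ⟨fun h => ⟨h.1, fun z hz => h.2.2 _ (hg z hz)⟩,
    fun h => ⟨h.1, hg y h.1, fun x hx => (hgy₀.2 x hx).trans (h.2 y₀ hy₀)⟩⟩

end Polytopes

/-! ### Faces of the Birkhoff polytope and their supports. -/

variable {n : ℕ}

/-- Birkhoff–von Neumann: the convex hull is traded for linear inequalities, the form in which
membership is always tested below. -/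
theorem mem_birkhoff {M : Matrix (Fin n) (Fin n) ℝ} :
    M ∈ birkhoff n ↔ (∀ i j, 0 ≤ M i j) ∧ (∀ i, ∑ j, M i j = 1) ∧ ∀ j, ∑ i, M i j = 1 := by
  rw [← mem_doublyStochastic_iff_sum, ← SetLike.mem_coe,
    doublyStochastic_eq_convexHull_permMatrix, birkhoff]
  simp only [eq_comm]

theorem birkhoff_convex : Convex ℝ (birkhoff n) := convex_convexHull ℝ _

/-- The entry of a matrix in position `(i, j)` as a continuous linear functional. -/
noncomputable def entry (i j : Fin n) : Matrix (Fin n) (Fin n) ℝ →L[ℝ] ℝ :=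
  LinearMap.toContinuousLinearMap (Matrix.entryLinearMap ℝ ℝ i j)

@[simp] theorem entry_apply (i j : Fin n) (M : Matrix (Fin n) (Fin n) ℝ) :
    entry i j M = M i j := rfl

/-- The doubly stochastic matrices vanishing on a set of positions form an exposed face. -/
theorem isExposed_vanishing (T : Fin n → Fin n → Prop) :
    IsExposed ℝ (birkhoff n) {x ∈ birkhoff n | ∀ i j, T i j → x i j = 0} := by
  classical
  rintro ⟨x₀, hx₀, h₀⟩
  have hl : ∀ x, (-∑ i, ∑ j, if T i j then entry i j else 0 :
      Matrix (Fin n) (Fin n) ℝ →L[ℝ] ℝ) x = -∑ i, ∑ j, if T i j then x i j else 0 := by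
    intro x
    simp only [_root_.neg_apply, _root_.sum_apply]
    congr 1
    refine sum_congr rfl fun i _ => sum_congr rfl fun j _ => ?_
    split_ifs <;> simp
  have hnn : ∀ x ∈ birkhoff n, ∀ i j, 0 ≤ if T i j then x i j else 0 := by
    intro x hx i j
    split_ifs
    exacts [(mem_birkhoff.1 hx).1 i j, le_rfl]
  -- This functional is nonpositive on the polytope and zero exactly when all entries in `T` vanish;
  -- `x₀` shows that the maximum `0` is attained.
  refine ⟨-∑ i, ∑ j, if T i j then entry i j else 0, ?_⟩
  ext x
  simp only [hl, Set.mem_ofPred_eq]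
  refine and_congr_right fun hx => ⟨fun h y hy => ?_, fun h i j hij => ?_⟩
  · rw [neg_le_neg_iff]
    refine sum_le_sum fun i _ => sum_le_sum fun j _ => ?_
    refine le_trans (le_of_eq ?_) (hnn y hy i j)
    split_ifs with hij
    exacts [h i j hij, rfl]
  · have h1 : ∑ i, ∑ j, (if T i j then x₀ i j else 0) = 0 :=
      sum_eq_zero fun i _ => sum_eq_zero fun j _ => by
        split_ifs with hij
        exacts [h₀ i j hij, rfl]
    have h2 := h x₀ hx₀
    rw [h1, neg_le_neg_iff] at h2
    have h3 := (sum_eq_zero_iff_of_nonneg fun i _ => sum_nonneg fun j _ => hnn x hx i j).1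
      (le_antisymm h2 (sum_nonneg fun i _ => sum_nonneg fun j _ => hnn x hx i j)) i (mem_univ i)
    have h4 := (sum_eq_zero_iff_of_nonneg fun j _ => hnn x hx i j).1 h3 j (mem_univ j)
    rwa [if_pos hij] at h4

/-- A nonempty convex set of nonnegative matrices has a member of maximal support. -/
theorem exists_maximal_support {F : Set (Matrix (Fin n) (Fin n) ℝ)} (hne : F.Nonempty)
    (hc : Convex ℝ F) (hnn : ∀ x ∈ F, ∀ i j, 0 ≤ x i j) :
    ∃ z ∈ F, ∀ x ∈ F, ∀ i j, z i j = 0 → x i j = 0 := by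
  classical
  obtain ⟨x₀, hx₀⟩ := hne
  have key : ∀ s : Finset (Fin n × Fin n),
      ∃ z ∈ F, ∀ x ∈ F, ∀ p ∈ s, z p.1 p.2 = 0 → x p.1 p.2 = 0 := by
    intro s
    induction s using Finset.induction_on with
    | empty => exact ⟨x₀, hx₀, by simp⟩
    | insert p s _ ih =>
      obtain ⟨z, hz, hzs⟩ := ih
      by_cases hp : ∃ y ∈ F, y p.1 p.2 ≠ 0
      · obtain ⟨y, hy, hyp⟩ := hp
        -- The support of a midpoint of nonnegative matrices is the union of the two supports.
        refine ⟨(1 / 2 : ℝ) • z + (1 / 2 : ℝ) • y,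
          hc hz hy (by norm_num) (by norm_num) (by norm_num), fun x hx q hq h => ?_⟩
        have hz0 := hnn z hz q.1 q.2
        have hy0 := hnn y hy q.1 q.2
        simp only [Matrix.add_apply, Matrix.smul_apply, smul_eq_mul] at h
        rcases Finset.mem_insert.1 hq with rfl | hq
        · exact absurd (by linarith) hyp
        · exact hzs x hx q hq (by linarith)
      · push Not at hp
        refine ⟨z, hz, fun x hx q hq h => ?_⟩
        rcases Finset.mem_insert.1 hq with rfl | hq
        exacts [hp x hx, hzs x hx q hq h]
  obtain ⟨z, hz, h⟩ := key univ
  exact ⟨z, hz, fun x hx i j => h x hx (i, j) (mem_univ _)⟩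

/-- If `h` vanishes wherever the nonnegative matrix `z` does, then `z + ε h` is nonnegative for
some `ε > 0`. -/
theorem exists_perturbation {z h : Matrix (Fin n) (Fin n) ℝ} (hz : ∀ i j, 0 ≤ z i j)
    (hh : ∀ i j, z i j = 0 → h i j = 0) : ∃ ε > 0, ∀ i j, 0 ≤ z i j + ε * h i j := by
  have hev : ∀ᶠ ε in nhdsWithin (0 : ℝ) (Set.Ioi 0), ∀ i j, 0 ≤ z i j + ε * h i j := by
    rw [Filter.eventually_all]
    intro i
    rw [Filter.eventually_all]
    intro j
    rcases (hz i j).eq_or_lt with h0 | h0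
    · rw [← h0, hh i j h0.symm]
      simp
    · have hcont : Filter.Tendsto (fun ε : ℝ => z i j + ε * h i j) (nhds 0)
          (nhds (z i j + 0 * h i j)) := Continuous.tendsto (by fun_prop) 0
      rw [zero_mul, add_zero] at hcont
      exact ((hcont.eventually (lt_mem_nhds h0)).mono fun _ => le_of_lt).filter_mono
        nhdsWithin_le_nhds
  obtain ⟨ε, h1, h2⟩ := (hev.and self_mem_nhdsWithin).exists
  exact ⟨ε, h2, h1⟩

/-- A nonempty face of a Birkhoff polytope is cut out by the support of one of its points. -/
theorem exists_support {F : Set (Matrix (Fin n) (Fin n) ℝ)} (hne : F.Nonempty)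
    (hF : IsExposed ℝ (birkhoff n) F) :
    ∃ z ∈ F, F = {x ∈ birkhoff n | ∀ i j, z i j = 0 → x i j = 0} := by
  obtain ⟨z, hz, hmax⟩ := exists_maximal_support hne (hF.convex birkhoff_convex)
    fun x hx => (mem_birkhoff.1 (hF.subset hx)).1
  refine ⟨z, hz, Set.Subset.antisymm (fun x hx => ⟨hF.subset hx, hmax x hx⟩) ?_⟩
  rintro x ⟨hx, hxz⟩
  obtain ⟨l, hl⟩ := hF hne
  have hz' := hz
  rw [hl] at hz'
  have hzB := mem_birkhoff.1 hz'.1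
  have hxB := mem_birkhoff.1 hx
  -- The segment from `x` to `z` extends slightly beyond `z` inside the polytope. As `l` is maximal
  -- at `z`, it cannot increase there, which forces `l z ≤ l x`.
  obtain ⟨ε, hε, hpos⟩ := exists_perturbation (h := z - x) hzB.1 fun i j h0 => by
    simp [h0, hxz i j h0]
  have hy : z + ε • (z - x) ∈ birkhoff n := by
    refine mem_birkhoff.2 ⟨hpos, fun i => ?_, fun j => ?_⟩
    · simp [sum_add_distrib, ← mul_sum, hzB.2.1, hxB.2.1]
    · simp [sum_add_distrib, ← mul_sum, hzB.2.2, hxB.2.2]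
  have h1 := hz'.2 _ hy
  rw [map_add, map_smul, map_sub, smul_eq_mul] at h1
  have h2 : l z ≤ l x := by nlinarith
  rw [hl]
  exact ⟨hx, fun y hy => (hz'.2 y hy).trans h2⟩

/-- The dimension of a face with support `S` is at least `|S| - 2 n + 1`. -/
theorem card_support_le {m d : ℕ} {F : Set (Matrix (Fin (m + 1)) (Fin (m + 1)) ℝ)}
    {z : Matrix (Fin (m + 1)) (Fin (m + 1)) ℝ} (hz : z ∈ F)
    (hF : F = {x ∈ birkhoff (m + 1) | ∀ i j, z i j = 0 → x i j = 0}) (hd : HasDim F d) :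
    #{p : Fin (m + 1) × Fin (m + 1) | z p.1 p.2 ≠ 0} ≤ d + (2 * m + 1) := by
  classical
  set S : Finset (Fin (m + 1) × Fin (m + 1)) := {p | z p.1 p.2 ≠ 0} with hS
  let extend : (S → ℝ) →ₗ[ℝ] Matrix (Fin (m + 1)) (Fin (m + 1)) ℝ :=
    { toFun := fun h => Matrix.of fun i j => if hp : (i, j) ∈ S then h ⟨(i, j), hp⟩ else 0
      map_add' := fun a b => by
        ext i j
        simp only [Matrix.add_apply, Matrix.of_apply, Pi.add_apply]
        split_ifs <;> simp
      map_smul' := fun c a => by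
        ext i j
        simp only [Matrix.smul_apply, Matrix.of_apply, Pi.smul_apply, RingHom.id_apply]
        split_ifs <;> simp }
  have hext : ∀ h i j, z i j = 0 → extend h i j = 0 := by
    intro h i j h0
    exact dif_neg (by simp [hS, h0])
  have hinj : Function.Injective extend := by
    intro a b hab
    ext ⟨⟨i, j⟩, hp⟩
    have := congrFun (congrFun hab i) j
    change (if hp : (i, j) ∈ S then a ⟨(i, j), hp⟩ else 0) =
      (if hp : (i, j) ∈ S then b ⟨(i, j), hp⟩ else 0) at this
    rwa [dif_pos hp, dif_pos hp] at this
  -- The last column sum is omitted because the row sums and the other column sums determine it;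
  -- this leaves `(m + 1) + m` conditions.
  let sums : Matrix (Fin (m + 1)) (Fin (m + 1)) ℝ →ₗ[ℝ] (Fin (m + 1) → ℝ) × (Fin m → ℝ) :=
    { toFun := fun x => (fun i => ∑ j, x i j, fun j => ∑ i, x i j.castSucc)
      map_add' := fun a b => by
        ext <;> simp [sum_add_distrib]
      map_smul' := fun c a => by
        ext <;> simp [mul_sum] }
  have hker : (LinearMap.ker (sums ∘ₗ extend)).map extend ≤ vectorSpan ℝ F := by
    rintro _ ⟨h, hh, rfl⟩
    have hsum : sums (extend h) = 0 := hh
    have hrow : ∀ i, ∑ j, extend h i j = 0 := fun i => congrFun (congrArg Prod.fst hsum) i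
    have hcol' : ∀ j : Fin m, ∑ i, extend h i j.castSucc = 0 :=
      fun j => congrFun (congrArg Prod.snd hsum) j
    have hcol : ∀ j, ∑ i, extend h i j = 0 := by
      intro j
      induction j using Fin.lastCases with
      | cast j => exact hcol' j
      | last =>
        have htot : ∑ j, ∑ i, extend h i j = 0 := by
          rw [sum_comm]
          exact sum_eq_zero fun i _ => hrow i
        rwa [Fin.sum_univ_castSucc, sum_eq_zero fun j _ => hcol' j, zero_add] at htot
    have hz' := hz
    rw [hF] at hz'
    have hzB := mem_birkhoff.1 hz'.1
    obtain ⟨ε, hε, hpos⟩ := exists_perturbation hzB.1 (hext h)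
    have hy : z + ε • extend h ∈ F := by
      rw [hF]
      refine ⟨mem_birkhoff.2 ⟨hpos, fun i => ?_, fun j => ?_⟩, fun i j h0 => ?_⟩
      · simp [sum_add_distrib, ← mul_sum, hzB.2.1, hrow]
      · simp [sum_add_distrib, ← mul_sum, hzB.2.2, hcol]
      · simp [h0, hext h i j h0]
    have hmem := vsub_mem_vectorSpan ℝ hy hz
    rw [vsub_eq_sub, add_sub_cancel_left] at hmem
    exact (Submodule.smul_mem_iff _ hε.ne').1 hmem
  have h1 := Submodule.finrank_mono hker
  rw [(Submodule.equivMapOfInjective extend hinj _).symm.finrank_eq, hd.2] at h1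
  have h2 := (sums ∘ₗ extend).finrank_range_add_finrank_ker
  have h3 := Submodule.finrank_le (LinearMap.range (sums ∘ₗ extend))
  simp only [Module.finrank_prod, Module.finrank_fintype_fun_eq_card, Fintype.card_fin,
    Fintype.card_coe] at h2 h3
  omega

/-! ### Removing a row and a column. -/

section Reduction

variable {m : ℕ}

/-- Delete row `v` and column `w`, adding column `w` to the column `j₀` of the result. -/
def mergeCols (v w : Fin (m + 1)) (j₀ : Fin m) :
    Matrix (Fin (m + 1)) (Fin (m + 1)) ℝ →ₗ[ℝ] Matrix (Fin m) (Fin m) ℝ where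
  toFun x := Matrix.of fun i j => x (v.succAbove i) (w.succAbove j) +
    if j = j₀ then x (v.succAbove i) w else 0
  map_add' a b := by
    ext i j
    simp only [Matrix.add_apply, Matrix.of_apply]
    split_ifs <;> ring
  map_smul' c a := by
    ext i j
    simp only [Matrix.smul_apply, Matrix.of_apply, RingHom.id_apply, smul_eq_mul]
    split_ifs <;> ring

theorem mergeCols_apply (v w : Fin (m + 1)) (j₀ : Fin m)
    (x : Matrix (Fin (m + 1)) (Fin (m + 1)) ℝ) (i j : Fin m) :
    mergeCols v w j₀ x i j = x (v.succAbove i) (w.succAbove j) +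
      if j = j₀ then x (v.succAbove i) w else 0 := rfl

/-- Insert a row `v` and a column `w`, moving to column `w` the entries of column `j₀` in the rows
`i` with `W i`, and filling row `v` so that row and column sums remain `1`. -/
def splitCol (v w : Fin (m + 1)) (j₀ : Fin m) (W : Fin m → Prop) [DecidablePred W] :
    Matrix (Fin m) (Fin m) ℝ →ₗ[ℝ] Matrix (Fin (m + 1)) (Fin (m + 1)) ℝ where
  toFun y := Matrix.of (v.insertNth (α := fun _ => Fin (m + 1) → ℝ)
    (w.insertNth (α := fun _ => ℝ) (∑ i, if W i then 0 else y i j₀)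
      fun j => if j = j₀ then ∑ i, (if W i then y i j₀ else 0) else 0)
    fun i => w.insertNth (α := fun _ => ℝ) (if W i then y i j₀ else 0)
      fun j => if j = j₀ ∧ W i then 0 else y i j)
  map_add' a b := by
    ext i j
    induction i using v.succAboveCases <;> induction j using w.succAboveCases <;>
      simp only [Matrix.add_apply, Matrix.of_apply, Fin.insertNth_apply_same,
        Fin.insertNth_apply_succAbove]
    · rw [← sum_add_distrib]
      exact sum_congr rfl fun i _ => by split_ifs <;> simp
    · split_ifs
      · rw [← sum_add_distrib]
        exact sum_congr rfl fun i _ => by split_ifs <;> simp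
      · simp
    · split_ifs <;> simp
    · split_ifs <;> simp
  map_smul' c a := by
    ext i j
    induction i using v.succAboveCases <;> induction j using w.succAboveCases <;>
      simp only [Matrix.smul_apply, Matrix.of_apply, Fin.insertNth_apply_same,
        Fin.insertNth_apply_succAbove, RingHom.id_apply, smul_eq_mul]
    · rw [mul_sum]
      exact sum_congr rfl fun i _ => by split_ifs <;> simp
    · split_ifs
      · rw [mul_sum]
        exact sum_congr rfl fun i _ => by split_ifs <;> simp
      · simp
    · split_ifs <;> simp
    · split_ifs <;> simp

section

variable (v w : Fin (m + 1)) (j₀ : Fin m) (W : Fin m → Prop) [DecidablePred W]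
  (y : Matrix (Fin m) (Fin m) ℝ)

theorem splitCol_same_same :
    splitCol v w j₀ W y v w = ∑ i, if W i then 0 else y i j₀ := by
  simp [splitCol]

theorem splitCol_same_succAbove (j : Fin m) :
    splitCol v w j₀ W y v (w.succAbove j) =
      if j = j₀ then ∑ i, (if W i then y i j₀ else 0) else 0 := by
  simp [splitCol]

theorem splitCol_succAbove_same (i : Fin m) :
    splitCol v w j₀ W y (v.succAbove i) w = if W i then y i j₀ else 0 := by
  simp [splitCol]

theorem splitCol_succAbove_succAbove (i j : Fin m) :
    splitCol v w j₀ W y (v.succAbove i) (w.succAbove j) =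
      if j = j₀ ∧ W i then 0 else y i j := by
  simp [splitCol]

/-- Merging restores whatever `W` moved, so this direction holds for every `W` and `y`; the other
composite needs the support conditions on the face. -/
theorem mergeCols_splitCol : mergeCols v w j₀ (splitCol v w j₀ W y) = y := by
  ext i j
  rw [mergeCols_apply, splitCol_succAbove_succAbove, splitCol_succAbove_same]
  by_cases hj : j = j₀ <;> by_cases hi : W i <;> simp [hi, hj]

variable {y} in
theorem splitCol_mem_birkhoff (hy : y ∈ birkhoff m) :
    splitCol v w j₀ W y ∈ birkhoff (m + 1) := by
  obtain ⟨hnn, hrow, hcol⟩ := mem_birkhoff.1 hy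
  have hsplit : (∑ i, if W i then 0 else y i j₀) + ∑ i, (if W i then y i j₀ else 0) = 1 := by
    rw [← sum_add_distrib, ← hcol j₀]
    exact sum_congr rfl fun i _ => by split_ifs <;> simp
  refine mem_birkhoff.2 ⟨fun i j => ?_, fun i => ?_, fun j => ?_⟩
  · induction i using v.succAboveCases <;> induction j using w.succAboveCases <;>
      simp only [splitCol_same_same, splitCol_same_succAbove, splitCol_succAbove_same,
        splitCol_succAbove_succAbove]
    · exact sum_nonneg fun i _ => by split_ifs <;> simp [hnn]
    · split_ifs
      · exact sum_nonneg fun i _ => by split_ifs <;> simp [hnn]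
      · exact le_rfl
    · split_ifs <;> simp [hnn]
    · split_ifs <;> simp [hnn]
  · rw [Fin.sum_univ_succAbove _ w]
    induction i using v.succAboveCases with
    | x =>
      simp only [splitCol_same_same, splitCol_same_succAbove, sum_ite_eq', mem_univ, if_true]
      exact hsplit
    | p i =>
      simp only [splitCol_succAbove_same, splitCol_succAbove_succAbove]
      rw [← hrow i]
      by_cases hi : W i
      · simp only [hi, if_true, and_true]
        rw [← sum_erase_add _ _ (mem_univ j₀), add_comm, ← sum_erase_add univ (y i) (mem_univ j₀),
          if_pos rfl, add_zero]
        congr 1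
        exact sum_congr rfl fun j hj => if_neg (ne_of_mem_erase hj)
      · simp [hi]
  · rw [Fin.sum_univ_succAbove _ v]
    induction j using w.succAboveCases with
    | x =>
      simp only [splitCol_same_same, splitCol_succAbove_same]
      exact hsplit
    | p j =>
      simp only [splitCol_same_succAbove, splitCol_succAbove_succAbove]
      by_cases hj : j = j₀
      · subst hj
        simp only [if_true, true_and]
        rw [add_comm]
        exact hsplit
      · simp [hj, hcol]

end

/-- If row `v` of a face is supported in two columns `u`, `w` whose supports are disjoint outside
row `v`, then a smaller Birkhoff polytope has a linearly isomorphic face. -/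
theorem exists_smaller_face {L : Type*} [PartialOrder L] {d : ℕ}
    {F : Set (Matrix (Fin (m + 1)) (Fin (m + 1)) ℝ)} (hF : IsBirkhoffFace (m + 1) d F)
    (hL : IsTypeOf L F) {v u w : Fin (m + 1)} (huw : u ≠ w)
    (hv : ∀ x ∈ F, ∀ j, j ≠ u → j ≠ w → x v j = 0)
    (hdisj : ∀ i, i ≠ v → (∀ x ∈ F, x i u = 0) ∨ ∀ x ∈ F, x i w = 0) :
    ∃ F' : Set (Matrix (Fin m) (Fin m) ℝ), IsBirkhoffFace m d F' ∧ IsTypeOf L F' := by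
  classical
  obtain ⟨-, hexp, hdim⟩ := hF
  obtain ⟨j₀, rfl⟩ := Fin.exists_succAbove_eq huw
  -- The support of column `w` outside row `v` tells which merged entries came from `w`.
  let W : Fin m → Prop := fun i => ∃ x ∈ F, x (v.succAbove i) w ≠ 0
  have hWu : ∀ x ∈ F, ∀ i, W i → x (v.succAbove i) (w.succAbove j₀) = 0 := by
    rintro x hx i ⟨x', hx', hne⟩
    exact (hdisj _ (Fin.succAbove_ne v i)).elim (fun h => h x hx) fun h => absurd (h x' hx') hne
  have hWw : ∀ x ∈ F, ∀ i, ¬ W i → x (v.succAbove i) w = 0 := by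
    intro x hx i hi
    by_contra h
    exact hi ⟨x, hx, h⟩
  have hvj : ∀ x ∈ F, ∀ j, j ≠ j₀ → x v (w.succAbove j) = 0 := fun x hx j hj =>
    hv x hx _ (fun h => hj (Fin.succAbove_right_injective h)) (Fin.succAbove_ne w j)
  have hvsum : ∀ x ∈ F, x v w + x v (w.succAbove j₀) = 1 := by
    intro x hx
    rw [← (mem_birkhoff.1 (hexp.subset hx)).2.1 v, Fin.sum_univ_succAbove _ w]
    congr 1
    exact (sum_eq_single j₀ (fun j _ hj => hvj x hx j hj) (by simp)).symm
  have hmem : ∀ x ∈ F, mergeCols v w j₀ x ∈ birkhoff m := by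
    intro x hx
    obtain ⟨hnn, hrow, hcol⟩ := mem_birkhoff.1 (hexp.subset hx)
    refine mem_birkhoff.2 ⟨fun i j => ?_, fun i => ?_, fun j => ?_⟩
    · rw [mergeCols_apply]
      have := hnn (v.succAbove i) (w.succAbove j)
      have := hnn (v.succAbove i) w
      split_ifs <;> linarith
    · simp only [mergeCols_apply, sum_add_distrib, sum_ite_eq', mem_univ, if_true]
      rw [← hrow (v.succAbove i), Fin.sum_univ_succAbove _ w, add_comm]
    · simp only [mergeCols_apply, sum_add_distrib]
      have h1 := hcol (w.succAbove j)
      have h2 := hcol w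
      rw [Fin.sum_univ_succAbove _ v] at h1 h2
      by_cases hj : j = j₀
      · subst hj
        have := hvsum x hx
        simp only [if_true]
        linarith
      · simp only [hj, if_false, sum_const_zero, add_zero]
        rwa [hvj x hx j hj, zero_add] at h1
  have hgf : ∀ x ∈ F, splitCol v w j₀ W (mergeCols v w j₀ x) = x := by
    intro x hx
    obtain ⟨hnn, hrow, hcol⟩ := mem_birkhoff.1 (hexp.subset hx)
    -- Each row other than `v` meets at most one of the two columns, so the merged entry is one of
    -- the two original entries and the other is zero.
    have hu' : ∀ i, (if W i then 0 else mergeCols v w j₀ x i j₀) =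
        x (v.succAbove i) (w.succAbove j₀) := by
      intro i
      rw [mergeCols_apply]
      by_cases hi : W i
      · simp [hi, hWu x hx i hi]
      · simp [hi, hWw x hx i hi]
    have hw' : ∀ i, (if W i then mergeCols v w j₀ x i j₀ else 0) = x (v.succAbove i) w := by
      intro i
      rw [mergeCols_apply]
      by_cases hi : W i
      · simp [hi, hWu x hx i hi]
      · simp [hi, hWw x hx i hi]
    have h1 := hcol (w.succAbove j₀)
    have h2 := hcol w
    rw [Fin.sum_univ_succAbove _ v] at h1 h2
    have h3 := hvsum x hx
    ext i j
    induction i using v.succAboveCases with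
    | x =>
      induction j using w.succAboveCases with
      | x =>
        rw [splitCol_same_same, sum_congr rfl fun i _ => hu' i]
        linarith
      | p j =>
        rw [splitCol_same_succAbove]
        split_ifs with hj
        · rw [sum_congr rfl fun i _ => hw' i, hj]
          linarith
        · exact (hvj x hx j hj).symm
    | p i =>
      induction j using w.succAboveCases with
      | x => rw [splitCol_succAbove_same, hw' i]
      | p j =>
        rw [splitCol_succAbove_succAbove]
        by_cases hj : j = j₀
        · subst hj
          simpa using hu' i
        · simp [hj, mergeCols_apply]
  have hf : ∀ x ∈ F, mergeCols v w j₀ x ∈ {y ∈ birkhoff m | splitCol v w j₀ W y ∈ F} :=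
    fun x hx => ⟨hmem x hx, by rwa [hgf x hx]⟩
  exact ⟨{y ∈ birkhoff m | splitCol v w j₀ W y ∈ F},
    ⟨j₀.pos, isExposed_preimage _ (fun y hy => splitCol_mem_birkhoff v w j₀ W hy) hexp,
      hdim.of_linear _ (splitCol v w j₀ W) hf (fun y hy => hy.2) hgf
        fun y _ => mergeCols_splitCol v w j₀ W y⟩,
    hL.of_linear _ (splitCol v w j₀ W) hf (fun y hy => hy.2) hgf
      fun y _ => mergeCols_splitCol v w j₀ W y⟩

end Reduction

/-! ### The wedge case. -/

/-- If row `v` of a face is supported exactly in two columns `u`, `w`, and another row `v'` meets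
both of them, then the face is a wedge. -/
theorem isWedgeOfLowerFace_of_common_row {L : Type*} [PartialOrder L] {d : ℕ}
    {F : Set (Matrix (Fin n) (Fin n) ℝ)} (hF : IsBirkhoffFace n d F) (hL : IsTypeOf L F)
    {z : Matrix (Fin n) (Fin n) ℝ} (hz : z ∈ F)
    (hFz : F = {x ∈ birkhoff n | ∀ i j, z i j = 0 → x i j = 0})
    {v v' u w : Fin n} (huw : u ≠ w) (hvv : v' ≠ v)
    (hv : ∀ j, z v j ≠ 0 ↔ j = u ∨ j = w) (hu' : z v' u ≠ 0) (hw' : z v' w ≠ 0) :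
    IsWedgeOfLowerFace L d := by
  classical
  obtain ⟨hn, hexp, hdim⟩ := hF
  -- The exchange direction: `+1` at `(v', u)` and `(v, w)`, `-1` at `(v', w)` and `(v, u)`. All
  -- four positions lie in the support, and all row and column sums are zero.
  let D : Matrix (Fin n) (Fin n) ℝ :=
    Matrix.vecMulVec (Pi.single v' 1 - Pi.single v 1) (Pi.single u 1 - Pi.single w 1)
  have hD : ∀ i j, D i j = (Pi.single v' 1 - Pi.single v 1 : Fin n → ℝ) i *
      (Pi.single u 1 - Pi.single w 1 : Fin n → ℝ) j := fun i j => rfl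
  have hDvu : D v u = -1 := by simp [hD, huw, hvv.symm]
  have hDvw : D v w = 1 := by simp [hD, huw.symm, hvv.symm]
  have hDvu' : D v' u = 1 := by simp [hD, huw, hvv]
  have hDvw' : D v' w = -1 := by simp [hD, huw.symm, hvv]
  have hDi : ∀ i j, i ≠ v → i ≠ v' → D i j = 0 := fun i j h h' => by simp [hD, h, h']
  have hDj : ∀ i j, j ≠ u → j ≠ w → D i j = 0 := fun i j h h' => by simp [hD, h, h']
  have hDrow : ∀ i, ∑ j, D i j = 0 := fun i => by
    simp only [hD, ← mul_sum]
    simp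
  have hDcol : ∀ j, ∑ i, D i j = 0 := fun j => by
    simp only [hD, ← sum_mul]
    simp
  have hDz : ∀ i j, z i j = 0 → D i j = 0 := by
    intro i j h0
    by_cases hj : j = u ∨ j = w
    · refine hDi i j ?_ ?_
      · rintro rfl
        exact (hv j).2 hj h0
      · rintro rfl
        rcases hj with rfl | rfl
        exacts [hu' h0, hw' h0]
    · push Not at hj
      exact hDj i j hj.1 hj.2
  have hvsum : ∀ x ∈ F, x v u + x v w = 1 := by
    intro x hx
    rw [hFz] at hx
    rw [← (mem_birkhoff.1 hx.1).2.1 v]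
    refine (sum_eq_add u w huw (fun j _ hj => ?_) (by simp) (by simp)).symm
    exact hx.2 v j (by_contra fun h => by simpa [hj.1, hj.2] using (hv j).1 h)
  have hcol : ∀ x ∈ F, ∀ j, x v j + x v' j ≤ 1 := by
    intro x hx j
    obtain ⟨hnn, -, hc⟩ := mem_birkhoff.1 (hexp.subset hx)
    rw [← hc j]
    exact add_le_sum (f := fun i => x i j) (fun i _ => hnn i j) (mem_univ v) (mem_univ v') hvv.symm
  have hmem : ∀ x ∈ F, ∀ t : ℝ, 0 ≤ x v u - t → 0 ≤ x v w + t → 0 ≤ x v' u + t →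
      0 ≤ x v' w - t → x + t • D ∈ F := by
    intro x hx t h1 h2 h3 h4
    rw [hFz] at hx ⊢
    obtain ⟨hnn, hr, hc⟩ := mem_birkhoff.1 hx.1
    refine ⟨mem_birkhoff.2 ⟨fun i j => ?_, fun i => ?_, fun j => ?_⟩, fun i j h0 => ?_⟩
    · rw [Matrix.add_apply, Matrix.smul_apply, smul_eq_mul]
      by_cases hj : j = u ∨ j = w
      · by_cases hi : i = v ∨ i = v'
        · rcases hi with rfl | rfl <;> rcases hj with rfl | rfl
          · rw [hDvu]; linarith
          · rw [hDvw]; linarith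
          · rw [hDvu']; linarith
          · rw [hDvw']; linarith
        · push Not at hi
          rw [hDi i j hi.1 hi.2, mul_zero, add_zero]
          exact hnn i j
      · push Not at hj
        rw [hDj i j hj.1 hj.2, mul_zero, add_zero]
        exact hnn i j
    · simp [sum_add_distrib, ← mul_sum, hr, hDrow]
    · simp [sum_add_distrib, ← mul_sum, hc, hDcol]
    · simp [hx.2 i j h0, hDz i j h0]
  let Q : Set (Matrix (Fin n) (Fin n) ℝ) := {x ∈ F | x v' w = 0}
  have hQF : Q ⊆ F := fun x hx => hx.1
  have hnnF : ∀ x ∈ F, ∀ i j, 0 ≤ x i j := fun x hx => (mem_birkhoff.1 (hexp.subset hx)).1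
  have hQ : Q = {x ∈ birkhoff n | ∀ i j, (z i j = 0 ∨ i = v' ∧ j = w) → x i j = 0} := by
    ext x
    simp only [Q, hFz, Set.mem_ofPred_eq]
    constructor
    · rintro ⟨⟨h1, h2⟩, h3⟩
      refine ⟨h1, fun i j h => ?_⟩
      rcases h with h | ⟨rfl, rfl⟩
      exacts [h2 i j h, h3]
    · rintro ⟨h1, h2⟩
      exact ⟨⟨h1, fun i j h => h2 i j (Or.inl h)⟩, h2 v' w (Or.inr ⟨rfl, rfl⟩)⟩
  have hQexp : IsExposed ℝ (birkhoff n) Q := hQ ▸ isExposed_vanishing _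
  -- Only the entry `(v, u)` could become negative. But `x v u = 1 - x v w ≥ x v' w`, by the sum of
  -- row `v` and the bound on column `w`.
  have hproj : ∀ x ∈ F, x + x v' w • D ∈ Q := by
    intro x hx
    have h1 := hvsum x hx
    have h2 := hcol x hx w
    have hnn := hnnF x hx
    refine ⟨hmem x hx _ (by linarith) (add_nonneg (hnn _ _) (hnn _ _))
      (add_nonneg (hnn _ _) (hnn _ _)) (by simp), ?_⟩
    simp [hDvw']
  -- The entry `(v', w)` vanishes on all directions of `Q`, but not on the direction from `z` to its
  -- projection.
  have hQlt : Module.finrank ℝ (vectorSpan ℝ Q) < d := by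
    rw [← hdim.2]
    refine Submodule.finrank_lt_finrank_of_lt (lt_of_le_of_ne (vectorSpan_mono ℝ hQF) fun h => ?_)
    have hker : vectorSpan ℝ Q ≤ LinearMap.ker (entry v' w : _ →ₗ[ℝ] ℝ) := by
      rw [vectorSpan_def, Submodule.span_le]
      rintro _ ⟨x, hx, y, hy, rfl⟩
      have h1 : x v' w = 0 := hx.2
      have h2 : y v' w = 0 := hy.2
      simp [h1, h2]
    have h1 := hker (h ▸ vsub_mem_vectorSpan ℝ hz (hQF (hproj z hz)))
    have h2 : (z + z v' w • D) v' w = 0 := (hproj z hz).2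
    rw [LinearMap.mem_ker, ContinuousLinearMap.coe_coe, entry_apply, vsub_eq_sub,
      Matrix.sub_apply, h2, sub_zero] at h1
    exact hw' h1
  have hval : ∀ x ∈ Q, (-entry v' u) x ≤ 0 := fun x hx => by
    simpa using hnnF x (hQF hx) v' u
  -- The wedge coordinate is the entry `(v', w)`, the base point the projection along `D`. The upper
  -- bound of the wedge is the entry `(v', u)` of the base point, so `R` is where that entry
  -- vanishes.
  let f : Matrix (Fin n) (Fin n) ℝ →ₗ[ℝ] Matrix (Fin n) (Fin n) ℝ × ℝ :=
    (LinearMap.id + (entry v' w : _ →ₗ[ℝ] ℝ).smulRight D).prod (entry v' w : _ →ₗ[ℝ] ℝ)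
  let g : Matrix (Fin n) (Fin n) ℝ × ℝ →ₗ[ℝ] Matrix (Fin n) (Fin n) ℝ :=
    LinearMap.fst ℝ _ _ - (LinearMap.snd ℝ _ _).smulRight D
  have hfa : ∀ x, f x = (x + x v' w • D, x v' w) := fun x => rfl
  have hga : ∀ p, g p = p.1 - p.2 • D := fun p => rfl
  refine ⟨n, _, Q, {x ∈ Q | (-entry v' u) x = 0}, hQlt, ⟨hn, hQexp, ⟨_, hproj z hz⟩, rfl⟩, ?_,
    -entry v' u, 0, ⟨hval, rfl⟩, hL.of_linear f g ?_ ?_ ?_ ?_⟩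
  · rintro ⟨x₀, hx₀, h₀⟩
    refine ⟨-entry v' u, Set.ext fun x => and_congr_right fun hx => ⟨fun h y hy => ?_, fun h => ?_⟩⟩
    · rw [h]
      exact hval y hy
    · exact le_antisymm (hval x hx) (h₀ ▸ h x₀ hx₀)
  · intro x hx
    refine ⟨hproj x hx, hnnF x hx v' w, ?_⟩
    simp [hfa, hDvu', hnnF x hx v' u]
  · rintro ⟨y, t⟩ ⟨hy, ht0, ht⟩
    have ht' : t ≤ y v' u := by simpa using ht
    have ht0' : 0 ≤ t := ht0
    have hyF : y ∈ F := hy.1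
    have hy0 : y v' w = 0 := hy.2
    have hnn := hnnF y hyF
    have h1 := hvsum y hyF
    have h2 := hcol y hyF u
    -- Here the entry `(v, w)` stays nonnegative because `t ≤ y v' u ≤ 1 - y v u = y v w`.
    have h3 := hmem y hyF (-t) (by linarith [hnn v u]) (by linarith) (by linarith) (by linarith)
    rw [hga, sub_eq_add_neg, ← neg_smul]
    exact h3
  · intro x _
    rw [hfa, hga, add_sub_cancel_right]
  · rintro ⟨y, t⟩ ⟨hy, -, -⟩
    have hy0 : y v' w = 0 := hy.2
    have : (y - t • D) v' w = t := by simp [hy0, hDvw']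
    rw [hga, hfa, this, sub_add_cancel]

/-! ### Counting and descent. -/

/-- A face of dimension at most `n` of the `n`-th Birkhoff polytope is a wedge, or a smaller
Birkhoff polytope has a face of the same type and dimension. -/
theorem isWedgeOfLowerFace_or_exists_smaller_face {L : Type*} [PartialOrder L] {m d : ℕ}
    (hd : 1 ≤ d) (hdm : d ≤ m + 1) {F : Set (Matrix (Fin (m + 1)) (Fin (m + 1)) ℝ)}
    (hF : IsBirkhoffFace (m + 1) d F) (hL : IsTypeOf L F) :
    IsWedgeOfLowerFace L d ∨
      ∃ F' : Set (Matrix (Fin m) (Fin m) ℝ), IsBirkhoffFace m d F' ∧ IsTypeOf L F' := by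
  classical
  obtain ⟨z, hz, hFz⟩ := exists_support hF.2.2.1 hF.2.1
  have hsub : ∀ x ∈ F, x ∈ birkhoff (m + 1) := fun x hx => hF.2.1.subset hx
  have hzx : ∀ x ∈ F, ∀ i j, z i j = 0 → x i j = 0 := fun x hx => by
    rw [hFz] at hx
    exact hx.2
  have hcard := card_support_le hz hFz hF.2.2
  -- Three positions in every row would give `3 (m + 1) ≤ d + (2 m + 1) ≤ 3 m + 2`.
  obtain ⟨v, hv⟩ : ∃ v, #{j | z v j ≠ 0} ≤ 2 := by
    by_contra! h
    have h1 : #{p : Fin (m + 1) × Fin (m + 1) | z p.1 p.2 ≠ 0} = ∑ v, #{j | z v j ≠ 0} := by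
      simp only [card_filter, Fintype.sum_prod_type]
    have h2 : ∑ _v : Fin (m + 1), 3 ≤ ∑ v, #{j | z v j ≠ 0} := sum_le_sum fun v _ => h v
    simp only [sum_const, card_univ, Fintype.card_fin, smul_eq_mul] at h2
    omega
  have hzB := mem_birkhoff.1 (hsub z hz)
  have hpos : #{j | z v j ≠ 0} ≠ 0 := by
    rw [card_ne_zero]
    obtain ⟨j, hj, h⟩ := exists_ne_zero_of_sum_ne_zero ((hzB.2.1 v).trans_ne one_ne_zero)
    exact ⟨j, by simpa using h⟩
  obtain h1 | h2 : #{j | z v j ≠ 0} = 1 ∨ #{j | z v j ≠ 0} = 2 := by omega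
  · right
    obtain ⟨w, hw⟩ := card_eq_one.1 h1
    have hw' : ∀ j, j ≠ w → z v j = 0 := by
      intro j hj
      by_contra h
      have : j ∈ ({j | z v j ≠ 0} : Finset _) := by simpa using h
      rw [hw] at this
      exact hj (mem_singleton.1 this)
    -- For `m = 0` the polytope is a point, against `1 ≤ d`; so a second column `u` exists.
    have hm : 0 < m := by
      rcases Nat.eq_zero_or_pos m with rfl | hm
      · exfalso
        have hsing : F.Subsingleton := by
          intro x hx y hy
          have hx' := (mem_birkhoff.1 (hsub x hx)).2.1
          have hy' := (mem_birkhoff.1 (hsub y hy)).2.1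
          have : Subsingleton (Fin (0 + 1)) := Fin.subsingleton_one
          ext i j
          rw [← Fintype.sum_subsingleton (x i) j, ← Fintype.sum_subsingleton (y i) j, hx' i, hy' i]
        have h0 := hF.2.2.2
        rw [(vectorSpan_of_subsingleton ℝ hsing), finrank_bot] at h0
        omega
      · exact hm
    have : Nontrivial (Fin (m + 1)) := Fin.nontrivial_iff_two_le.2 (by omega)
    obtain ⟨u, hu⟩ := exists_ne w
    -- The entry `(v, w)` equals `1`, so column `w` vanishes outside row `v` and any other column
    -- can play the role of `u`.
    refine exists_smaller_face hF hL hu (fun x hx j _ hj => hzx x hx v j (hw' j hj))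
      fun i hi => Or.inr fun x hx => ?_
    obtain ⟨hnn, hr, hc⟩ := mem_birkhoff.1 (hsub x hx)
    have hvw : x v w = 1 := by
      rw [← hr v]
      exact (sum_eq_single w (fun j _ hj => hzx x hx v j (hw' j hj)) (by simp)).symm
    have h3 : x v w + x i w ≤ 1 := by
      rw [← hc w]
      exact add_le_sum (f := fun i => x i w) (fun i _ => hnn i w) (mem_univ v) (mem_univ i) hi.symm
    linarith [hnn i w]
  · obtain ⟨u, w, huw, hs⟩ := card_eq_two.1 h2
    have hvz : ∀ j, z v j ≠ 0 ↔ j = u ∨ j = w := by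
      intro j
      have : j ∈ ({j | z v j ≠ 0} : Finset _) ↔ j ∈ ({u, w} : Finset _) := by rw [hs]
      simpa using this
    by_cases hcommon : ∃ v', v' ≠ v ∧ z v' u ≠ 0 ∧ z v' w ≠ 0
    · obtain ⟨v', hvv, hu', hw'⟩ := hcommon
      exact Or.inl (isWedgeOfLowerFace_of_common_row hF hL hz hFz huw hvv hvz hu' hw')
    · push Not at hcommon
      refine Or.inr (exists_smaller_face hF hL huw (fun x hx j hju hjw => hzx x hx v j ?_) ?_)
      · by_contra h
        exact ((hvz j).1 h).elim hju hjw
      · intro i hi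
        by_cases hiu : z i u = 0
        · exact Or.inl fun x hx => hzx x hx i u hiu
        · exact Or.inr fun x hx => hzx x hx i w (hcommon i hi hiu)

/-- A face of positive dimension `d` whose type occurs in no `n`-th Birkhoff polytope with `n < d`
is a wedge. -/
theorem isWedgeOfLowerFace_of_le_bdim {L : Type*} [PartialOrder L] {d : ℕ} (hd : 1 ≤ d)
    (hbdim : d ≤ bdim L) : ∀ (n : ℕ) (F : Set (Matrix (Fin n) (Fin n) ℝ)),
      IsBirkhoffFace n d F → IsTypeOf L F → IsWedgeOfLowerFace L d
  | 0, _, hF, _ => absurd hF.1 (lt_irrefl 0)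
  | m + 1, F, hF, hL => by
    -- The bound `d ≤ n` persists through the descent because the type `L` never changes.
    have hle : d ≤ m + 1 := hbdim.trans (Nat.sInf_le ⟨hF.1, F, hF.2.1, hL⟩)
    obtain h | ⟨F', hF', hL'⟩ := isWedgeOfLowerFace_or_exists_smaller_face hd hle hF hL
    exacts [h, isWedgeOfLowerFace_of_le_bdim hd hbdim m F' hF' hL']

end BirkhoffFaces

theorem mainTheorem3 (L : Type*) [PartialOrder L] (d : ℕ) (hd : 1 ≤ d)
    (hL : ∃ (n : ℕ) (F : Set (Matrix (Fin n) (Fin n) ℝ)),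
      BirkhoffFaces.IsBirkhoffFace n d F ∧ BirkhoffFaces.IsTypeOf L F)
    (hbdim : d ≤ BirkhoffFaces.bdim L) :
    BirkhoffFaces.IsWedgeOfLowerFace L d ∨ BirkhoffFaces.IsProductOfLowerFaces L d := by
  obtain ⟨n, F, hF, hLF⟩ := hL
  exact Or.inl (BirkhoffFaces.isWedgeOfLowerFace_of_le_bdim hd hbdim n F hF hLF)
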